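/- Let $n\ge 3$. A *zonotope* in $\mathbb{R}^n$ is a finite Minkowski sum of line segments, and a *zonoid* is a nonempty compact convex set in $\mathbb{R}^n$ that is the limit, in the Hausdorff metric, of a sequence of zonotopes. Let $\mathcal{Z}^n_s$ be the class of zonoids $K$ in $\mathbb{R}^n$ that are $o$-symmetric, i.e., $K=-K$ (their interiors may be empty), and let $*:\left(\mathcal{Z}^n_s\right)^2\to\mathcal{Z}^n_s$ be an arbitrary map. Then $*$ has the following three properties: 1. (continuity in the Hausdorff metric) if $K_m,L_m,M,N\in\mathcal{Z}^n_s$ and $K_m\to M$, $L_m\to N$ in the Hausdorff metric as $m\to\infty$, then $K_m*L_m\to M*N$ in the Hausdorff metric; 2. ($GL(n)$ covariance) $\phi(K*L)=(\phi K)*(\phi L)$ for all $\phi\in GL(n)$ and all $K,L\in\mathcal{Z}^n_s$; 3. (identity property) $K*\{o\}=K=\{o\}*K$ for all $K\in\mathcal{Z}^n_s$; if and only if $*$ is Minkowski addition, i.e., $K*L=K+L=\{x+y: x\in K,\ y\in L\}$ for all $K,L\in\mathcal{Z}^n_s$. -/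

import Mathlib

open Filter Topology

/-- The line segment `[x, y]` in `ℝⁿ`, as a nonempty compact convex set. -/
def segmentBody {n : ℕ} (x y : EuclideanSpace ℝ (Fin n)) :
    ConvexBody (EuclideanSpace ℝ (Fin n)) where
  carrier := segment ℝ x y
  convex' := convex_segment x y
  isCompact' := by
    rw [segment_eq_image_lineMap]
    exact isCompact_Icc.image AffineMap.lineMap_continuous
  nonempty' := ⟨x, left_mem_segment ℝ x y⟩

/-- A zonotope is a finite Minkowski sum of line segments. -/
def IsZonotope {n : ℕ} (P : ConvexBody (EuclideanSpace ℝ (Fin n))) : Prop :=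
  ∃ (k : ℕ) (x y : Fin k → EuclideanSpace ℝ (Fin n)), P = ∑ i, segmentBody (x i) (y i)

/-- A zonoid is a limit of zonotopes in the Hausdorff metric
(which is the metric that Mathlib puts on `ConvexBody`). -/
def IsZonoid {n : ℕ} (Z : ConvexBody (EuclideanSpace ℝ (Fin n))) : Prop :=
  ∃ P : ℕ → ConvexBody (EuclideanSpace ℝ (Fin n)),
    (∀ m, IsZonotope (P m)) ∧ Tendsto P atTop (𝓝 Z)

/-- The class of `o`-symmetric zonoids in `ℝⁿ` (interiors may be empty),
a subtype of `ConvexBody` and hence a metric space under the Hausdorff metric. -/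
abbrev SymmZonoid (n : ℕ) : Type :=
  {Z : ConvexBody (EuclideanSpace ℝ (Fin n)) // IsZonoid Z ∧ ∀ x ∈ Z, -x ∈ Z}

/-- The image `φ K` of a nonempty compact convex set under an invertible linear map. -/
def glImageBody {n : ℕ} (φ : EuclideanSpace ℝ (Fin n) ≃L[ℝ] EuclideanSpace ℝ (Fin n))
    (K : ConvexBody (EuclideanSpace ℝ (Fin n))) : ConvexBody (EuclideanSpace ℝ (Fin n)) where
  carrier := φ '' (K : Set (EuclideanSpace ℝ (Fin n)))
  convex' := K.convex.linear_image φ.toLinearEquiv.toLinearMap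
  isCompact' := K.isCompact.image φ.continuous
  nonempty' := K.nonempty.image φ

theorem glImageBody_segmentBody {n : ℕ}
    (φ : EuclideanSpace ℝ (Fin n) ≃L[ℝ] EuclideanSpace ℝ (Fin n))
    (x y : EuclideanSpace ℝ (Fin n)) :
    glImageBody φ (segmentBody x y) = segmentBody (φ x) (φ y) :=
  ConvexBody.ext (image_segment ℝ φ.toLinearEquiv.toLinearMap.toAffineMap x y)

theorem glImageBody_sum {n k : ℕ}
    (φ : EuclideanSpace ℝ (Fin n) ≃L[ℝ] EuclideanSpace ℝ (Fin n))
    (K : Fin k → ConvexBody (EuclideanSpace ℝ (Fin n))) :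
    glImageBody φ (∑ i, K i) = ∑ i, glImageBody φ (K i) := by
  let f : ConvexBody (EuclideanSpace ℝ (Fin n)) →+ ConvexBody (EuclideanSpace ℝ (Fin n)) :=
    { toFun := glImageBody φ
      map_zero' := ConvexBody.ext (by
        change φ '' ({0} : Set (EuclideanSpace ℝ (Fin n))) = {0}
        simp)
      map_add' := fun A B => ConvexBody.ext (Set.image_add φ) }
  exact map_sum f K Finset.univ

theorem continuous_glImageBody {n : ℕ}
    (φ : EuclideanSpace ℝ (Fin n) ≃L[ℝ] EuclideanSpace ℝ (Fin n)) :
    Continuous (glImageBody φ) := by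
  obtain ⟨C, hC⟩ : ∃ C, LipschitzWith C φ := ⟨_, φ.lipschitz⟩
  have h : LipschitzWith C (glImageBody φ) := by
    intro K L
    rw [← ConvexBody.hausdorffEDist_coe, ← ConvexBody.hausdorffEDist_coe]
    have key : ∀ A B : ConvexBody (EuclideanSpace ℝ (Fin n)), ∀ x ∈ A,
        ∃ y ∈ glImageBody φ B, edist (φ x) y ≤
          C * Metric.hausdorffEDist (A : Set (EuclideanSpace ℝ (Fin n))) B := by
      intro A B x hx
      obtain ⟨y, hy, hxy⟩ := B.isCompact.exists_infEDist_eq_edist B.nonempty x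
      refine ⟨φ y, ⟨y, hy, rfl⟩, (hC x y).trans ?_⟩
      rw [← hxy]
      gcongr
      exact Metric.infEDist_le_hausdorffEDist_of_mem hx
    refine Metric.hausdorffEDist_le_of_mem_edist ?_ ?_
    · rintro _ ⟨x, hx, rfl⟩
      exact key K L x hx
    · rintro _ ⟨x, hx, rfl⟩
      rw [Metric.hausdorffEDist_comm]
      exact key L K x hx
  exact h.continuous

theorem IsZonoid.glImageBody {n : ℕ} {Z : ConvexBody (EuclideanSpace ℝ (Fin n))}
    (hZ : IsZonoid Z) (φ : EuclideanSpace ℝ (Fin n) ≃L[ℝ] EuclideanSpace ℝ (Fin n)) :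
    IsZonoid (glImageBody φ Z) := by
  obtain ⟨P, hP, hlim⟩ := hZ
  refine ⟨fun m => _root_.glImageBody φ (P m), fun m => ?_,
    ((continuous_glImageBody φ).tendsto Z).comp hlim⟩
  obtain ⟨k, x, y, h⟩ := hP m
  refine ⟨k, fun i => φ (x i), fun i => φ (y i), ?_⟩
  simp only [h, glImageBody_sum, glImageBody_segmentBody]

namespace SymmZonoid

/-- The image `φ K` of an `o`-symmetric zonoid under `φ ∈ GL(n)`. -/
def glImage {n : ℕ} (φ : EuclideanSpace ℝ (Fin n) ≃L[ℝ] EuclideanSpace ℝ (Fin n))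
    (K : SymmZonoid n) : SymmZonoid n :=
  ⟨glImageBody φ K.1, K.2.1.glImageBody φ, by
    rintro _ ⟨x, hx, rfl⟩
    exact ⟨-x, K.2.2 x hx, map_neg φ x⟩⟩

/-- The singleton `{o}` as an `o`-symmetric zonoid. -/
def origin (n : ℕ) : SymmZonoid n :=
  ⟨0, ⟨fun _ => 0, fun _ => ⟨0, 0, 0, by simp⟩, tendsto_const_nhds⟩, by
    rintro x (rfl : x = 0)
    exact neg_zero⟩

/-- Continuity in the Hausdorff metric: `K_m → M` and `L_m → N` imply `K_m * L_m → M * N`. -/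
def HausdorffContinuous {n : ℕ} (op : SymmZonoid n → SymmZonoid n → SymmZonoid n) : Prop :=
  ∀ (K L : ℕ → SymmZonoid n) (M N : SymmZonoid n),
    Tendsto K atTop (𝓝 M) → Tendsto L atTop (𝓝 N) →
      Tendsto (fun m => op (K m) (L m)) atTop (𝓝 (op M N))

/-- `GL(n)` covariance: `φ (K * L) = φ K * φ L` for all `φ ∈ GL(n)`. -/
def GLCovariant {n : ℕ} (op : SymmZonoid n → SymmZonoid n → SymmZonoid n) : Prop :=
  ∀ (φ : EuclideanSpace ℝ (Fin n) ≃L[ℝ] EuclideanSpace ℝ (Fin n)) (K L : SymmZonoid n),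
    glImage φ (op K L) = op (glImage φ K) (glImage φ L)

/-- The identity property: `K * {o} = K = {o} * K`. -/
def HasIdentityProperty {n : ℕ} (op : SymmZonoid n → SymmZonoid n → SymmZonoid n) : Prop :=
  ∀ K : SymmZonoid n, op K (origin n) = K ∧ op (origin n) K = K

/-- The operation is Minkowski addition (`+` on `ConvexBody` is the Minkowski sum of sets). -/
def IsMinkowskiAddition {n : ℕ} (op : SymmZonoid n → SymmZonoid n → SymmZonoid n) : Prop :=
  ∀ K L : SymmZonoid n, (op K L).1 = K.1 + L.1

end SymmZonoid

/-! Write `h_K` for the support function. A linear map fixing a unit vector `v` and shrinking its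
orthogonal complement to zero flattens a symmetric body `K` to the segment `h_K(v)[-v, v]`.
Continuity and covariance therefore reduce the operation to segments on a line: `h_{K*L} = f(h_K,
h_L)` for a single positively homogeneous `f`, with `f(s, 0) = |s|` and `f(0, t) = |t|`
(`support_op`).

So far `f` could be an `L_p` norm; what excludes this is that the values must be zonoids. In
dimension at least 3, test on `Z = ([-e₀, e₀] + [-e₁, e₁]) * [-e₂, e₂]`, whose support function is
`f(|x| + |y|, |z|)` on the span of the `eᵢ`. It has a ridge along `x = 0`, so its second differences
in direction `e₀` are first differences of `f` in its first argument. For zonoids, such second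
differences at many equispaced points are controlled by those at the origin and at one nearby point
(`IsZonoid.sum_secondDifference_le`). For the convex function `g(s) = f(s, 1)` this bounds later
slopes by `(g(b) - 1) / b`; since `s ≤ g(s) ≤ s + 1`, only `g(s) = s + 1` survives
(`eq_add_one_of_sum_sub_le`). -/

open scoped RealInnerProductSpace Pointwise

/-! ### Support functions and Hausdorff distance of convex bodies. -/

namespace ConvexBody

section SupportFunction

variable {V : Type*} [NormedAddCommGroup V] [InnerProductSpace ℝ V]

/-- The support function `u ↦ max {⟪x, u⟫ | x ∈ K}` of a convex body. -/
noncomputable def support (K : ConvexBody V) (u : V) : ℝ :=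
  sSup ((fun x => ⟪x, u⟫) '' (K : Set V))

theorem exists_inner_eq_support (K : ConvexBody V) (u : V) : ∃ x ∈ K, ⟪x, u⟫ = K.support u := by
  have hc : ContinuousOn (fun x : V => ⟪x, u⟫) (K : Set V) := by fun_prop
  obtain ⟨x, hx, h, -⟩ := K.isCompact.exists_sSup_image_eq_and_ge K.nonempty hc
  exact ⟨x, hx, h.symm⟩

theorem inner_le_support {K : ConvexBody V} {x : V} (hx : x ∈ K) (u : V) :
    ⟪x, u⟫ ≤ K.support u := by
  have hc : ContinuousOn (fun x : V => ⟪x, u⟫) (K : Set V) := by fun_prop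
  exact le_csSup (K.isCompact.image_of_continuousOn hc).bddAbove ⟨x, hx, rfl⟩

theorem support_le {K : ConvexBody V} {u : V} {c : ℝ} (h : ∀ x ∈ K, ⟪x, u⟫ ≤ c) :
    K.support u ≤ c := by
  obtain ⟨x, hx, hxu⟩ := K.exists_inner_eq_support u
  exact hxu ▸ h x hx

theorem support_add_right (K : ConvexBody V) (u v : V) :
    K.support (u + v) ≤ K.support u + K.support v :=
  support_le fun x hx => by
    rw [inner_add_right]
    exact add_le_add (inner_le_support hx u) (inner_le_support hx v)

theorem support_smul_right (K : ConvexBody V) (u : V) {c : ℝ} (hc : 0 ≤ c) :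
    K.support (c • u) = c * K.support u := by
  apply le_antisymm
  · refine support_le fun x hx => ?_
    rw [real_inner_smul_right]
    exact mul_le_mul_of_nonneg_left (inner_le_support hx u) hc
  · obtain ⟨x, hx, hxu⟩ := K.exists_inner_eq_support u
    rw [← hxu, ← real_inner_smul_right]
    exact inner_le_support hx _

@[simp]
theorem support_zero_right (K : ConvexBody V) : K.support 0 = 0 := by
  simpa using K.support_smul_right 0 le_rfl

@[simp]
theorem support_zero (u : V) : (0 : ConvexBody V).support u = 0 := by
  obtain ⟨x, hx, hxu⟩ := (0 : ConvexBody V).exists_inner_eq_support u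
  obtain rfl : x = 0 := hx
  rw [← hxu, inner_zero_left]

theorem support_add (K L : ConvexBody V) (u : V) :
    (K + L).support u = K.support u + L.support u := by
  apply le_antisymm
  · refine support_le ?_
    rintro _ ⟨x, hx, y, hy, rfl⟩
    rw [inner_add_left]
    exact add_le_add (inner_le_support hx u) (inner_le_support hy u)
  · obtain ⟨x, hx, hxu⟩ := K.exists_inner_eq_support u
    obtain ⟨y, hy, hyu⟩ := L.exists_inner_eq_support u
    rw [← hxu, ← hyu, ← inner_add_left]
    exact inner_le_support (Set.add_mem_add hx hy) u

theorem support_sum {ι : Type*} (s : Finset ι) (K : ι → ConvexBody V) (u : V) :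
    (∑ i ∈ s, K i).support u = ∑ i ∈ s, (K i).support u :=
  map_sum (⟨⟨fun K => K.support u, support_zero u⟩, fun K L => support_add K L u⟩ :
    ConvexBody V →+ ℝ) K s

theorem exists_dist_le (K L : ConvexBody V) {x : V} (hx : x ∈ K) :
    ∃ y ∈ L, dist x y ≤ dist K L := by
  obtain ⟨y, hy, hxy⟩ := L.isCompact.exists_infDist_eq_dist L.nonempty x
  refine ⟨y, hy, ?_⟩
  rw [← hxy]
  exact Metric.infDist_le_hausdorffDist_of_mem hx hausdorffEDist_ne_top

theorem dist_le_of_forall_exists {K L : ConvexBody V} {r : ℝ} (hr : 0 ≤ r)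
    (h₁ : ∀ x ∈ K, ∃ y ∈ L, dist x y ≤ r) (h₂ : ∀ y ∈ L, ∃ x ∈ K, dist y x ≤ r) :
    dist K L ≤ r :=
  Metric.hausdorffDist_le_of_mem_dist hr h₁ h₂

theorem support_le_add_dist (K L : ConvexBody V) (u : V) :
    K.support u ≤ L.support u + dist K L * ‖u‖ := by
  refine support_le fun x hx => ?_
  obtain ⟨y, hy, hxy⟩ := exists_dist_le K L hx
  have h₁ : ⟪x, u⟫ = ⟪y, u⟫ + ⟪x - y, u⟫ := by rw [inner_sub_left]; ring
  have h₂ : ⟪x - y, u⟫ ≤ dist K L * ‖u‖ :=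
    (real_inner_le_norm _ _).trans <| by
      rw [← dist_eq_norm]
      gcongr
  linarith [inner_le_support hy u]

theorem continuous_support (u : V) : Continuous fun K : ConvexBody V => K.support u :=
  (LipschitzWith.of_le_add_mul (f := fun K : ConvexBody V => K.support u) ‖u‖₊ fun K L => by
    simpa [mul_comm] using support_le_add_dist K L u).continuous

theorem dist_add_add_le (K L M N : ConvexBody V) :
    dist (K + L) (M + N) ≤ dist K M + dist L N := by
  have key : ∀ K L M N : ConvexBody V, ∀ x ∈ K + L, ∃ y ∈ M + N,
      dist x y ≤ dist K M + dist L N := by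
    rintro K L M N _ ⟨x, hx, y, hy, rfl⟩
    obtain ⟨x', hx', hxx'⟩ := exists_dist_le K M hx
    obtain ⟨y', hy', hyy'⟩ := exists_dist_le L N hy
    exact ⟨x' + y', Set.add_mem_add hx' hy', (_root_.dist_add_add_le _ _ _ _).trans
      (add_le_add hxx' hyy')⟩
  refine dist_le_of_forall_exists (by positivity) (key K L M N) ?_
  rw [dist_comm K, dist_comm L]
  exact key M N K L

theorem tendsto_add {α : Type*} {l : Filter α} {K L : α → ConvexBody V} {M N : ConvexBody V}
    (hK : Tendsto K l (𝓝 M)) (hL : Tendsto L l (𝓝 N)) :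
    Tendsto (fun a => K a + L a) l (𝓝 (M + N)) := by
  rw [tendsto_iff_dist_tendsto_zero] at *
  exact squeeze_zero (fun _ => dist_nonneg) (fun a => dist_add_add_le (K a) (L a) M N)
    (by simpa using hK.add hL)

theorem abs_inner_le_support {K : ConvexBody V} (hK : ∀ x ∈ K, -x ∈ K) {x : V} (hx : x ∈ K)
    (u : V) : |⟪x, u⟫| ≤ K.support u := by
  refine abs_le'.2 ⟨inner_le_support hx u, ?_⟩
  rw [← inner_neg_left]
  exact inner_le_support (hK x hx) u

theorem support_nonneg {K : ConvexBody V} (hK : ∀ x ∈ K, -x ∈ K) (u : V) : 0 ≤ K.support u := by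
  obtain ⟨x, hx⟩ := K.nonempty
  exact (abs_nonneg _).trans (abs_inner_le_support hK hx u)

variable [CompleteSpace V]

/-- A point of `K` outside `L` would be strictly separated from `L` by a functional, which the Riesz
isomorphism turns into a direction `u` violating `h`. -/
theorem subset_of_support_le {K L : ConvexBody V} (h : ∀ u, K.support u ≤ L.support u) :
    (K : Set V) ⊆ L := by
  intro x hx
  by_contra hxL
  obtain ⟨f, c, hc, hcx⟩ := geometric_hahn_banach_closed_point L.convex L.isClosed hxL
  obtain ⟨u, rfl⟩ := (InnerProductSpace.toDual ℝ V).surjective f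
  simp only [InnerProductSpace.toDual_apply_apply] at hc hcx
  have h₁ : L.support u ≤ c := support_le fun y hy => by
    rw [real_inner_comm]
    exact (hc y hy).le
  have h₂ := inner_le_support hx u
  rw [real_inner_comm] at h₂
  linarith [h u]

theorem ext_support {K L : ConvexBody V} (h : ∀ u, K.support u = L.support u) : K = L :=
  ConvexBody.ext <| (subset_of_support_le fun u => (h u).le).antisymm
    (subset_of_support_le fun u => (h u).ge)

end SupportFunction

end ConvexBody

/-! ### Segments, and Minkowski sums of zonoids. -/

section Segments

variable {n : ℕ}

local notation "E" => EuclideanSpace ℝ (Fin n)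

theorem support_segmentBody (x y u : E) :
    (segmentBody x y).support u = max ⟪x, u⟫ ⟪y, u⟫ := by
  apply le_antisymm
  · refine ConvexBody.support_le ?_
    rintro _ ⟨a, b, ha, hb, hab, rfl⟩
    rw [inner_add_left, real_inner_smul_left, real_inner_smul_left]
    exact Convex.combo_le_max _ _ ha hb hab
  · exact max_le (ConvexBody.inner_le_support (left_mem_segment ℝ x y) u)
      (ConvexBody.inner_le_support (right_mem_segment ℝ x y) u)

/-- Midpoint plus half-vector: the linear midpoint term disappears from second differences, leaving
one absolute value. -/
theorem support_segmentBody_eq_abs (x y u : E) :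
    (segmentBody x y).support u =
      ⟪(2 : ℝ)⁻¹ • (x + y), u⟫ + |⟪(2 : ℝ)⁻¹ • (y - x), u⟫| := by
  rw [support_segmentBody]
  simp only [real_inner_smul_left, inner_add_left, inner_sub_left, abs_mul]
  rw [abs_of_pos (by norm_num : (0 : ℝ) < 2⁻¹)]
  rcases le_total ⟪x, u⟫ ⟪y, u⟫ with h | h
  · rw [max_eq_right h, abs_of_nonneg (sub_nonneg.2 h)]
    ring
  · rw [max_eq_left h, abs_of_nonpos (sub_nonpos.2 h)]
    ring

theorem glImageBody_add (φ : E ≃L[ℝ] E) (K L : ConvexBody E) :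
    glImageBody φ (K + L) = glImageBody φ K + glImageBody φ L :=
  ConvexBody.ext (Set.image_add φ)

theorem IsZonotope.add {P Q : ConvexBody E} (hP : IsZonotope P) (hQ : IsZonotope Q) :
    IsZonotope (P + Q) := by
  obtain ⟨k, x, y, rfl⟩ := hP
  obtain ⟨l, x', y', rfl⟩ := hQ
  refine ⟨k + l, Fin.append x x', Fin.append y y', ?_⟩
  simp [Fin.sum_univ_add]

theorem IsZonoid.add {Y Z : ConvexBody E} (hY : IsZonoid Y) (hZ : IsZonoid Z) :
    IsZonoid (Y + Z) := by
  obtain ⟨P, hP, hPY⟩ := hY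
  obtain ⟨Q, hQ, hQZ⟩ := hZ
  exact ⟨fun m => P m + Q m, fun m => (hP m).add (hQ m), ConvexBody.tendsto_add hPY hQZ⟩

namespace SymmZonoid

/-- The segment `[-v, v]` as an `o`-symmetric zonoid. -/
def seg (v : E) : SymmZonoid n :=
  ⟨segmentBody (-v) v,
    ⟨fun _ => segmentBody (-v) v, fun _ => ⟨1, fun _ => -v, fun _ => v, by simp⟩,
      tendsto_const_nhds⟩, by
    rintro _ ⟨a, b, ha, hb, hab, rfl⟩
    exact ⟨b, a, hb, ha, by rw [add_comm, hab], by simp [add_comm]⟩⟩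

/-- The Minkowski sum of two `o`-symmetric zonoids. -/
def add (K L : SymmZonoid n) : SymmZonoid n :=
  ⟨K.1 + L.1, K.2.1.add L.2.1, by
    rintro _ ⟨x, hx, y, hy, rfl⟩
    exact ⟨-x, K.2.2 x hx, -y, L.2.2 y hy, (neg_add x y).symm⟩⟩

theorem support_seg (v u : E) : (seg v).1.support u = |⟪v, u⟫| := by
  change (segmentBody (-v) v).support u = _
  rw [support_segmentBody, inner_neg_left, max_comm]
  rfl

theorem support_add (K L : SymmZonoid n) (u : E) :
    (add K L).1.support u = K.1.support u + L.1.support u :=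
  ConvexBody.support_add K.1 L.1 u

theorem glImage_seg (φ : E ≃L[ℝ] E) (v : E) : glImage φ (seg v) = seg (φ v) :=
  Subtype.ext <| (glImageBody_segmentBody φ (-v) v).trans (by rw [map_neg]; rfl)

theorem seg_zero : seg (0 : E) = origin n :=
  Subtype.ext <| ConvexBody.ext_support fun u => by
    rw [support_seg, inner_zero_left, abs_zero]
    exact (ConvexBody.support_zero u).symm

theorem smul_mem_seg {v : E} {c d : ℝ} (h : |c| ≤ d) : c • v ∈ (seg (d • v)).1 := by
  rcases eq_or_ne d 0 with rfl | hd
  · obtain rfl : c = 0 := by simpa using h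
    exact right_mem_segment ℝ _ _
  have hd : 0 < d := lt_of_le_of_ne ((abs_nonneg c).trans h) hd.symm
  obtain ⟨h₁, h₂⟩ := abs_le.1 h
  refine ⟨(1 - c / d) / 2, (1 + c / d) / 2, ?_, ?_, by ring, ?_⟩
  · have := (div_le_one hd).2 h₂
    linarith
  · have : -1 ≤ c / d := by rw [le_div_iff₀ hd]; linarith
    linarith
  · rw [← neg_smul, smul_smul, smul_smul, ← add_smul]
    congr 1
    field_simp
    ring

theorem exists_of_mem_seg {w y : E} (h : y ∈ (seg w).1) : ∃ c : ℝ, |c| ≤ 1 ∧ y = c • w := by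
  obtain ⟨a, b, ha, hb, hab, rfl⟩ := h
  refine ⟨b - a, abs_le.2 ⟨by linarith, by linarith⟩, ?_⟩
  rw [sub_smul, smul_neg]
  abel

end SymmZonoid

end Segments

/-! ### Second differences of absolute values. -/

section SecondDifference

variable {V : Type*} [AddCommGroup V] [Module ℝ V]

/-- The symmetric second difference `h(u + w) + h(u - w) - 2 h(u)`. -/
def secondDifference (w : V) (h : V → ℝ) (u : V) : ℝ :=
  h (u + w) + h (u - w) - 2 * h u

theorem abs_add_add_abs_sub (A s : ℝ) :
    |s + A| + |s - A| - 2 * |s| = 2 * max (|A| - |s|) 0 := by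
  rcases le_total 0 A with hA | hA <;> rcases le_total 0 s with hs | hs <;>
  rcases le_total 0 (s + A) with h₁ | h₁ <;> rcases le_total 0 (s - A) with h₂ | h₂ <;>
  simp only [abs_of_nonneg, abs_of_nonpos, hA, hs, h₁, h₂] <;>
  first
  | rw [max_eq_left (by linarith)]; linarith
  | rw [max_eq_right (by linarith)]; linarith

/-- If two of the equispaced numbers `(c + i) p + q` are smaller than `A` in absolute value, then
`|q|` is at most a constant times `A`; otherwise at most one summand on the left is nonzero. -/
theorem sum_max_sub_abs_le (N : ℕ) {c : ℝ} (hc : 0 ≤ c) (A p q : ℝ) (hA : 0 ≤ A) :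
    ∑ i ∈ Finset.range N, max (A - |(c + i) * p + q|) 0 ≤
      A + N * max (A - (N * (1 + 2 * (c + N)))⁻¹ * |q|) 0 := by
  set f : ℕ → ℝ := fun i => max (A - |(c + i) * p + q|) 0 with hf
  have hfA : ∀ i, f i ≤ A := fun i => max_le (by linarith [abs_nonneg ((c + i) * p + q)]) hA
  have hR : 0 ≤ N * max (A - (N * (1 + 2 * (c + N)))⁻¹ * |q|) 0 := by positivity
  by_cases h : ∀ i ∈ Finset.range N, ∀ j ∈ Finset.range N, i ≠ j → f i = 0 ∨ f j = 0
  · suffices ∑ i ∈ Finset.range N, f i ≤ A by linarith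
    by_cases h0 : ∃ i ∈ Finset.range N, f i ≠ 0
    · obtain ⟨i, hi, hi0⟩ := h0
      rw [Finset.sum_eq_single_of_mem i hi fun j hj hji => (h j hj i hi hji).resolve_right hi0]
      exact hfA i
    · push Not at h0
      rw [Finset.sum_eq_zero h0]
      exact hA
  · push Not at h
    obtain ⟨i, hi, j, hj, hij, hi0, hj0⟩ := h
    have hlt : ∀ k, f k ≠ 0 → |(c + k) * p + q| < A := fun k hk => by
      by_contra hcon
      exact hk (max_eq_right (by linarith))
    have hiA := hlt i hi0
    have hjA := hlt j hj0
    have hdiff : (1 : ℝ) ≤ |(i : ℝ) - j| := by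
      have : (1 : ℤ) ≤ |(i : ℤ) - j| := Int.one_le_abs (by omega)
      exact_mod_cast this
    have hp : |p| ≤ 2 * A := by
      have h₁ : |(i : ℝ) - j| * |p| ≤ |(c + i) * p + q| + |(c + j) * p + q| := by
        rw [← abs_mul]
        refine le_trans (le_of_eq ?_) (abs_sub _ _)
        congr 1
        ring
      nlinarith [abs_nonneg p]
    have hiN : (i : ℝ) ≤ N := by exact_mod_cast (Finset.mem_range.1 hi).le
    have hN : (0 : ℝ) < N := by exact_mod_cast (Nat.zero_le i).trans_lt (Finset.mem_range.1 hi)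
    have hq : |q| ≤ (1 + 2 * (c + N)) * A := by
      have h₁ : |q| ≤ |(c + i) * p + q| + (c + i) * |p| := by
        have : 0 ≤ c + (i : ℝ) := by positivity
        rw [← abs_of_nonneg this, ← abs_mul, abs_of_nonneg this]
        refine le_trans (le_of_eq ?_) (abs_sub _ _)
        congr 1
        ring
      have h₂ : (c + i) * |p| ≤ (c + N) * (2 * A) := by gcongr
      linarith
    have hC : 0 < 1 + 2 * (c + N) := by positivity
    -- The extra factor `N` in the constant leaves at least `A - A / N` in the maximum; `N` times
    -- this, plus the leading `A`, covers the trivial bound `N * A`.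
    have hq' : (N * (1 + 2 * (c + N)))⁻¹ * |q| ≤ (N : ℝ)⁻¹ * A := by
      rw [mul_inv, mul_assoc]
      gcongr
      rwa [inv_mul_le_iff₀ hC]
    calc ∑ k ∈ Finset.range N, f k ≤ ∑ _k ∈ Finset.range N, A := Finset.sum_le_sum fun k _ => hfA k
      _ = A + N * (A - (N : ℝ)⁻¹ * A) := by
        rw [Finset.sum_const, Finset.card_range, nsmul_eq_mul]
        field_simp
        ring
      _ ≤ A + N * max (A - (N * (1 + 2 * (c + N)))⁻¹ * |q|) 0 := by
        gcongr
        exact le_max_of_le_left (by linarith)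

end SecondDifference

/-! ### The second difference inequality for zonoids. -/

section Zonoids

variable {n : ℕ}

local notation "E" => EuclideanSpace ℝ (Fin n)

theorem secondDifference_support_segmentBody (x y w u : E) :
    secondDifference w (segmentBody x y).support u =
      2 * max (|⟪(2 : ℝ)⁻¹ • (y - x), w⟫| - |⟪(2 : ℝ)⁻¹ • (y - x), u⟫|) 0 := by
  rw [← abs_add_add_abs_sub]
  simp only [secondDifference, support_segmentBody_eq_abs, inner_add_right, inner_sub_right]
  ring

/-- An inequality between second differences that holds for the support functions of zonoids. -/
theorem IsZonoid.sum_secondDifference_le {Z : ConvexBody E} (hZ : IsZonoid Z) (N : ℕ) {c : ℝ}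
    (hc : 0 ≤ c) (w a b : E) :
    ∑ i ∈ Finset.range N, secondDifference w Z.support ((c + i) • a + b) ≤
      secondDifference w Z.support 0 +
        N * secondDifference w Z.support ((N * (1 + 2 * (c + N)) : ℝ)⁻¹ • b) := by
  obtain ⟨P, hP, hlim⟩ := hZ
  -- The inequality is linear in the support function and closed under pointwise limits, so segments
  -- suffice.
  have hseg : ∀ x y : E, ∑ i ∈ Finset.range N,
      secondDifference w (segmentBody x y).support ((c + i) • a + b) ≤
      secondDifference w (segmentBody x y).support 0 +
        N * secondDifference w (segmentBody x y).support
          ((N * (1 + 2 * (c + N)) : ℝ)⁻¹ • b) := by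
    intro x y
    simp only [secondDifference_support_segmentBody, ← Finset.mul_sum]
    have := sum_max_sub_abs_le N hc |⟪(2 : ℝ)⁻¹ • (y - x), w⟫| ⟪(2 : ℝ)⁻¹ • (y - x), a⟫
      ⟪(2 : ℝ)⁻¹ • (y - x), b⟫ (abs_nonneg _)
    have hpos : 0 ≤ (N * (1 + 2 * (c + N)) : ℝ)⁻¹ := by positivity
    rw [inner_zero_right, abs_zero, sub_zero, max_eq_left (abs_nonneg _)]
    have hb : |⟪(2 : ℝ)⁻¹ • (y - x), (N * (1 + 2 * (c + N)) : ℝ)⁻¹ • b⟫| =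
        (N * (1 + 2 * (c + N)) : ℝ)⁻¹ * |⟪(2 : ℝ)⁻¹ • (y - x), b⟫| := by
      rw [real_inner_smul_right, abs_mul, abs_of_nonneg hpos]
    simp only [hb, inner_add_right, real_inner_smul_right _ a]
    linarith
  have hzono : ∀ m, ∑ i ∈ Finset.range N,
      secondDifference w (P m).support ((c + i) • a + b) ≤
      secondDifference w (P m).support 0 +
        N * secondDifference w (P m).support ((N * (1 + 2 * (c + N)) : ℝ)⁻¹ • b) := by
    intro m
    obtain ⟨k, x, y, hPm⟩ := hP m
    have hsum : ∀ u, secondDifference w (P m).support u =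
        ∑ j, secondDifference w (segmentBody (x j) (y j)).support u := by
      intro u
      simp only [secondDifference, hPm, ConvexBody.support_sum, Finset.sum_sub_distrib,
        Finset.sum_add_distrib, Finset.mul_sum]
    simp only [hsum]
    rw [Finset.sum_comm, Finset.mul_sum, ← Finset.sum_add_distrib]
    exact Finset.sum_le_sum fun j _ => hseg (x j) (y j)
  have hcont : ∀ u, Tendsto (fun m => secondDifference w (P m).support u) atTop
      (𝓝 (secondDifference w Z.support u)) := by
    have hs : ∀ v, Tendsto (fun m => (P m).support v) atTop (𝓝 (Z.support v)) := fun v =>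
      ((ConvexBody.continuous_support v).tendsto Z).comp hlim
    exact fun u => ((hs _).add (hs _)).sub ((hs _).const_mul 2)
  exact le_of_tendsto_of_tendsto' (tendsto_finsetSum _ fun i _ => hcont _)
    ((hcont _).add ((hcont _).const_mul _)) hzono

end Zonoids

/-! ### Rigidity of a convex function of one variable. -/

/-- A function on the half-line which is convex, lies between `s` and `s + 1`, and satisfies the
second difference inequality of a zonoid is the function `s ↦ s + 1`. -/
theorem eq_add_one_of_sum_sub_le {g : ℝ → ℝ} (hconv : ConvexOn ℝ (Set.Ici 0) g)
    (hlow : ∀ s, 0 ≤ s → s ≤ g s) (hup : ∀ s, 0 ≤ s → g s ≤ s + 1)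
    (h : ∀ (N : ℕ) (c ε : ℝ), 0 < N → 0 ≤ c → 0 < ε →
      ∑ i ∈ Finset.range N, (g (c + i + ε) - g (c + i)) ≤
        ε + N * ((N * (1 + 2 * (c + N)) : ℝ)⁻¹ *
          (g (ε * (N * (1 + 2 * (c + N)))) - 1)))
    {b : ℝ} (hb : 0 < b) : g b = b + 1 := by
  refine le_antisymm (hup b hb.le) ?_
  -- the slope over `[b, c]` bounds the slope over `[0, b]` from below, up to `1 / N`
  have hslope : ∀ c, b < c → ∀ N : ℕ, 0 < N → (g c - g b) / (c - b) ≤ 1 / N + (g b - 1) / b := by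
    intro c hbc N hN
    have hN' : (0 : ℝ) < N := by exact_mod_cast hN
    have hc : 0 < c := hb.trans hbc
    set D : ℝ := N * (1 + 2 * (c + N)) with hD
    have hDpos : 0 < D := by positivity
    -- The step `ε = b / D` makes `ε * D = b`, so the right side of `h` evaluates `g` exactly at
    -- `b`.
    have hε : 0 < b / D := by positivity
    have h₁ := h N c (b / D) hN hc.le hε
    rw [← hD, div_mul_cancel₀ _ hDpos.ne'] at h₁
    -- Each interval `[c + i, c + i + ε]` lies to the right of `[b, c]`, so by convexity its slope
    -- is at least as large. The case `i = 0` is separate because the intermediate interval `[c, c +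
    -- i]` degenerates.
    have h₂ : ∀ i ∈ Finset.range N,
        (g c - g b) / (c - b) * (b / D) ≤ g (c + i + b / D) - g (c + i) := by
      intro i _
      have hi : (0 : ℝ) ≤ i := by positivity
      have h₃ : (g c - g b) / (c - b) ≤
          (g (c + i + b / D) - g (c + i)) / (c + i + b / D - (c + i)) := by
        have s₁ := hconv.slope_mono_adjacent (x := b) (y := c) (z := c + i + b / D) hb.le
          (Set.mem_Ici.2 (by positivity)) hbc (by linarith)
        rcases hi.eq_or_lt with h0 | h0
        · rw [← h0, add_zero] at s₁ ⊢
          exact s₁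
        · exact (hconv.slope_mono_adjacent (x := b) (y := c) (z := c + i) hb.le
            (Set.mem_Ici.2 (by positivity)) hbc (by linarith)).trans
            (hconv.slope_mono_adjacent (x := c) (y := c + i) (z := c + i + b / D) hc.le
            (Set.mem_Ici.2 (by positivity)) (by linarith) (by linarith))
      rwa [add_sub_cancel_left, le_div_iff₀ hε] at h₃
    have h₄ := Finset.card_nsmul_le_sum _ _ _ h₂
    rw [Finset.card_range, nsmul_eq_mul] at h₄
    have h₅ : N * ((g c - g b) / (c - b) * (b / D)) ≤
        N * (b / D) * (1 / N + (g b - 1) / b) := by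
      refine (h₄.trans h₁).trans (le_of_eq ?_)
      field_simp
    refine le_of_mul_le_mul_left ?_ (mul_pos hN' hε)
    linarith
  have hslope' : ∀ c, b < c → (g c - g b) / (c - b) ≤ (g b - 1) / b := by
    intro c hbc
    have hlim := (tendsto_one_div_atTop_nhds_zero_nat (𝕜 := ℝ)).add_const ((g b - 1) / b)
    rw [zero_add] at hlim
    exact ge_of_tendsto hlim ((eventually_gt_atTop 0).mono fun N hN => hslope c hbc N hN)
  -- If `g b < b + 1`, then beyond `b` the graph stays below a line of slope `m < 1`, which
  -- eventually falls under `s ↦ s`, against `hlow`.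
  by_contra! hlt
  have hm : (g b - 1) / b < 1 := by
    rw [div_lt_one hb]
    linarith
  set m := (g b - 1) / b
  obtain ⟨c, hcb, hc⟩ : ∃ c, b < c ∧ g b - m * b < c * (1 - m) := by
    have : Tendsto (fun c : ℝ => c * (1 - m)) atTop atTop :=
      tendsto_id.atTop_mul_const (by linarith)
    exact ((eventually_gt_atTop b).and (this.eventually_gt_atTop _)).exists
  have := hslope' c hcb
  rw [div_le_iff₀ (by linarith)] at this
  linarith [hlow c (hb.trans hcb).le]

/-! ### Flattening onto a line, and reduction to a function of two reals. -/

section Squeeze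

variable {V : Type*} [NormedAddCommGroup V] [InnerProductSpace ℝ V]

/-- For a unit vector `v`, the map that fixes `v` and scales its orthogonal complement by `ε`. -/
noncomputable def squeeze (v : V) (hv : ‖v‖ = 1) (ε : ℝ) (hε : ε ≠ 0) : V ≃L[ℝ] V :=
  ContinuousLinearEquiv.equivOfInverse
    ((innerSL ℝ v).smulRight v +
      ε • (ContinuousLinearMap.id ℝ V - (innerSL ℝ v).smulRight v))
    ((innerSL ℝ v).smulRight v +
      ε⁻¹ • (ContinuousLinearMap.id ℝ V - (innerSL ℝ v).smulRight v))
    (fun x => by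
      simp [inner_add_right, inner_sub_right, real_inner_smul_right, hv, smul_smul, hε])
    (fun x => by
      simp [inner_add_right, inner_sub_right, real_inner_smul_right, hv, smul_smul, hε])

theorem squeeze_apply (v : V) (hv : ‖v‖ = 1) (ε : ℝ) (hε : ε ≠ 0) (x : V) :
    squeeze v hv ε hε x = ⟪x, v⟫ • v + ε • (x - ⟪x, v⟫ • v) := by
  rw [real_inner_comm]
  rfl

end Squeeze

namespace SymmZonoid

variable {n : ℕ}

local notation "E" => EuclideanSpace ℝ (Fin n)

theorem support_glImage_smul (K : SymmZonoid n) (u : E) {c : ℝ} (hc : c ≠ 0) :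
    (glImage (ContinuousLinearEquiv.smulLeft (Units.mk0 c hc)) K).1.support u =
      K.1.support (c • u) := by
  apply le_antisymm
  · refine ConvexBody.support_le ?_
    rintro _ ⟨x, hx, rfl⟩
    have := ConvexBody.inner_le_support hx (c • u)
    rw [real_inner_smul_right, ← real_inner_smul_left] at this
    exact this
  · refine ConvexBody.support_le fun x hx => ?_
    rw [real_inner_smul_right, ← real_inner_smul_left]
    refine ConvexBody.inner_le_support
      (K := (glImage (ContinuousLinearEquiv.smulLeft (Units.mk0 c hc)) K).1) ?_ u
    exact ⟨x, hx, rfl⟩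

/-- The limit is the orthogonal projection of `K` to the line of `v`, and symmetry makes this a
centred segment. Boundedness of `K` makes the convergence uniform. -/
theorem tendsto_glImage_squeeze (K : SymmZonoid n) (v : E) (hv : ‖v‖ = 1) :
    Tendsto (fun m : ℕ => glImage (squeeze v hv (1 / ((m : ℝ) + 1)) (by positivity)) K) atTop
      (𝓝 (seg (K.1.support v • v))) := by
  obtain ⟨R, hR, hKR⟩ := K.1.isBounded.exists_pos_norm_le
  have hproj : ∀ x ∈ K.1, ‖x - ⟪x, v⟫ • v‖ ≤ 2 * R := fun x hx => by
    have h₁ := hKR x hx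
    calc ‖x - ⟪x, v⟫ • v‖ ≤ ‖x‖ + ‖⟪x, v⟫ • v‖ := norm_sub_le _ _
      _ ≤ ‖x‖ + ‖x‖ := by
        gcongr
        rw [norm_smul, hv, mul_one, Real.norm_eq_abs]
        simpa [hv] using abs_real_inner_le_norm x v
      _ ≤ 2 * R := by linarith
  have hdist : ∀ (ε : ℝ) (hε : ε ≠ 0), ∀ x ∈ K.1,
      dist (squeeze v hv ε hε x) (⟪x, v⟫ • v) ≤ |ε| * (2 * R) := fun ε hε x hx => by
    rw [squeeze_apply, dist_eq_norm, add_sub_cancel_left, norm_smul, Real.norm_eq_abs]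
    exact mul_le_mul_of_nonneg_left (hproj x hx) (abs_nonneg ε)
  have hbound : ∀ (ε : ℝ) (hε : ε ≠ 0),
      dist (glImage (squeeze v hv ε hε) K) (seg (K.1.support v • v)) ≤ |ε| * (2 * R) := by
    intro ε hε
    refine ConvexBody.dist_le_of_forall_exists (by positivity) ?_ ?_
    · rintro _ ⟨x, hx, rfl⟩
      exact ⟨⟪x, v⟫ • v, smul_mem_seg (ConvexBody.abs_inner_le_support K.2.2 hx v),
        hdist ε hε x hx⟩
    · intro y hy
      obtain ⟨c, hc, rfl⟩ := exists_of_mem_seg hy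
      obtain ⟨x, hx, hxv⟩ := K.1.exists_inner_eq_support v
      obtain ⟨hc₁, hc₂⟩ := abs_le.1 hc
      have hcx : c • x ∈ K.1 := by
        have := K.1.convex hx (K.2.2 x hx) (a := (1 + c) / 2) (b := (1 - c) / 2)
          (by linarith) (by linarith) (by ring)
        rw [smul_neg, ← sub_eq_add_neg, ← sub_smul] at this
        rwa [show (1 + c) / 2 - (1 - c) / 2 = c by ring] at this
      refine ⟨squeeze v hv ε hε (c • x), ⟨c • x, hcx, rfl⟩, ?_⟩
      have := hdist ε hε (c • x) hcx
      rwa [real_inner_smul_left, hxv, dist_comm, ← smul_smul] at this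
  rw [tendsto_iff_dist_tendsto_zero]
  refine squeeze_zero (fun _ => dist_nonneg) (fun m => hbound _ _) ?_
  simpa using (tendsto_one_div_add_atTop_nhds_zero_nat (𝕜 := ℝ)).abs.mul_const (2 * R)

variable {op : SymmZonoid n → SymmZonoid n → SymmZonoid n}

/-- The function `f(s, t)` with `s[-e, e] * t[-e, e] = f(s, t)[-e, e]`. -/
noncomputable def scalarOp (op : SymmZonoid n → SymmZonoid n → SymmZonoid n) (e : E) (s t : ℝ) :
    ℝ :=
  (op (seg (s • e)) (seg (t • e))).1.support e

theorem scalarOp_mul (hgl : GLCovariant op) (e : E) {c : ℝ} (hc : 0 < c) (s t : ℝ) :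
    scalarOp op e (c * s) (c * t) = c * scalarOp op e s t := by
  have h := hgl (ContinuousLinearEquiv.smulLeft (Units.mk0 c hc.ne')) (seg (s • e)) (seg (t • e))
  rw [glImage_seg, glImage_seg] at h
  have h' : ∀ r : ℝ, (ContinuousLinearEquiv.smulLeft (Units.mk0 c hc.ne') : E ≃L[ℝ] E) (r • e) =
      (c * r) • e := fun r => smul_smul c r e
  rw [h', h'] at h
  rw [scalarOp, ← h, support_glImage_smul, ConvexBody.support_smul_right _ _ hc.le]
  rfl

/-- By covariance, squeezing `K` and `L` squeezes `op K L`; both sides are limits of the same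
sequence. -/
theorem op_seg_support (hcont : HausdorffContinuous op) (hgl : GLCovariant op)
    (K L : SymmZonoid n) {v : E} (hv : ‖v‖ = 1) :
    op (seg (K.1.support v • v)) (seg (L.1.support v • v)) =
      seg ((op K L).1.support v • v) := by
  have h := hcont _ _ _ _ (tendsto_glImage_squeeze K v hv) (tendsto_glImage_squeeze L v hv)
  exact tendsto_nhds_unique h
    ((tendsto_glImage_squeeze (op K L) v hv).congr fun m => hgl _ K L)

theorem scalarOp_zero_right (hid : HasIdentityProperty op) {e : E} (he : ‖e‖ = 1) (s : ℝ) :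
    scalarOp op e s 0 = |s| := by
  rw [scalarOp, zero_smul, seg_zero, (hid _).1, support_seg, real_inner_smul_left,
    real_inner_self_eq_norm_sq, he, one_pow, mul_one]

theorem scalarOp_zero_left (hid : HasIdentityProperty op) {e : E} (he : ‖e‖ = 1) (t : ℝ) :
    scalarOp op e 0 t = |t| := by
  rw [scalarOp, zero_smul, seg_zero, (hid _).2, support_seg, real_inner_smul_left,
    real_inner_self_eq_norm_sq, he, one_pow, mul_one]

theorem support_op (hcont : HausdorffContinuous op) (hgl : GLCovariant op)
    (hid : HasIdentityProperty op) {e : E} (he : ‖e‖ = 1) (K L : SymmZonoid n) (u : E) :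
    (op K L).1.support u = scalarOp op e (K.1.support u) (L.1.support u) := by
  have hunit : ∀ v : E, ‖v‖ = 1 →
      (op K L).1.support v = scalarOp op e (K.1.support v) (L.1.support v) := by
    intro v hv
    -- Moving `v` to the fixed `e` shows that the scalar function does not depend on the direction.
    obtain ⟨φ, hφ⟩ : ∃ φ : E ≃L[ℝ] E, φ v = e :=
      SeparatingDual.exists_continuousLinearEquiv_apply_eq
        (norm_ne_zero_iff.1 (by simp [hv])) (norm_ne_zero_iff.1 (by simp [he]))
    have h := congrArg (glImage φ) (op_seg_support hcont hgl K L hv)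
    rw [hgl, glImage_seg, glImage_seg, glImage_seg] at h
    simp only [map_smul, hφ] at h
    rw [scalarOp, h, support_seg, real_inner_smul_left, real_inner_self_eq_norm_sq, he, one_pow,
      mul_one, abs_of_nonneg (ConvexBody.support_nonneg (op K L).2.2 v)]
  rcases eq_or_ne u 0 with rfl | hu
  · simp [scalarOp_zero_right hid he]
  · have hu' : 0 < ‖u‖ := norm_pos_iff.2 hu
    have h := hunit (‖u‖⁻¹ • u) (by rw [norm_smul, norm_inv, norm_norm, inv_mul_cancel₀ hu'.ne'])
    have hpos : 0 ≤ ‖u‖⁻¹ := by positivity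
    rw [ConvexBody.support_smul_right _ _ hpos, ConvexBody.support_smul_right _ _ hpos,
      ConvexBody.support_smul_right _ _ hpos, scalarOp_mul hgl e (inv_pos.2 hu')] at h
    exact mul_left_cancel₀ (inv_pos.2 hu').ne' h

/-! ### The test body, and determination of the scalar function. -/

/-- Restricting the support function of `([-e₁, e₁] + [-e₂, e₂]) * [-e₃, e₃]` to the span of the
orthonormal vectors `e₁, e₂, e₃`. -/
theorem support_op_orthonormal (hcont : HausdorffContinuous op) (hgl : GLCovariant op)
    (hid : HasIdentityProperty op) {e : Fin 3 → E} (he : Orthonormal ℝ e) (x y z : ℝ) :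
    (op (add (seg (e 0)) (seg (e 1))) (seg (e 2))).1.support (x • e 0 + y • e 1 + z • e 2) =
      scalarOp op (e 0) (|x| + |y|) |z| := by
  rw [support_op hcont hgl hid (he.1 0)]
  have h := orthonormal_iff_ite.1 he
  simp [support_add, support_seg, inner_add_right, real_inner_smul_right, h, he.1]

theorem scalarOp_one (hcont : HausdorffContinuous op) (hgl : GLCovariant op)
    (hid : HasIdentityProperty op) {e : Fin 3 → E} (he : Orthonormal ℝ e) {s : ℝ} (hs : 0 < s) :
    scalarOp op (e 0) s 1 = s + 1 := by
  set f := scalarOp op (e 0) with hf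
  set Z := op (add (seg (e 0)) (seg (e 1))) (seg (e 2))
  have hZ : ∀ x y z : ℝ, Z.1.support (x • e 0 + y • e 1 + z • e 2) = f (|x| + |y|) |z| :=
    support_op_orthonormal hcont hgl hid he
  have hf0 : ∀ t, f t 0 = |t| := scalarOp_zero_right hid (he.1 0)
  have h0f : ∀ t, f 0 t = |t| := scalarOp_zero_left hid (he.1 0)
  have hmul : ∀ c s t, 0 < c → f (c * s) (c * t) = c * f s t := fun c s t hc =>
    scalarOp_mul hgl (e 0) hc s t
  have hZg : ∀ s, 0 ≤ s → Z.1.support (s • e 1 + e 2) = f s 1 := fun s hs => by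
    simpa [abs_of_nonneg hs] using hZ 0 s 1
  refine eq_add_one_of_sum_sub_le (g := fun s => f s 1) ?_ ?_ ?_ ?_ hs
  · refine ⟨convex_Ici 0, fun x hx y hy a b ha hb hab => ?_⟩
    have hx : 0 ≤ x := hx
    have hy : 0 ≤ y := hy
    simp only [smul_eq_mul]
    rw [← hZg x hx, ← hZg y hy, ← hZg _ (by positivity), ← ConvexBody.support_smul_right _ _ ha,
      ← ConvexBody.support_smul_right _ _ hb]
    refine le_trans (le_of_eq ?_) (ConvexBody.support_add_right _ _ _)
    congr 1
    have : e 2 = a • e 2 + b • e 2 := by rw [← add_smul, hab, one_smul]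
    nth_rewrite 1 [this]
    module
  · intro s hs
    -- The two vectors are reflections of each other, so both have support value `f s 1`, while
    -- their sum has value `2 * s`.
    have h₁ := ConvexBody.support_add_right Z.1 (s • e 1 + e 2) (s • e 1 - e 2)
    have h₂ := hZ 0 s (-1)
    have h₃ := hZ 0 (2 * s) 0
    simp only [abs_zero, zero_smul, zero_add, abs_neg, abs_one, neg_smul, one_smul, add_zero,
      ← sub_eq_add_neg, hf0, abs_abs, abs_of_nonneg hs] at h₂ h₃
    rw [abs_of_nonneg (by positivity)] at h₃
    rw [show s • e 1 + e 2 + (s • e 1 - e 2) = (2 * s) • e 1 by module, h₂, h₃, hZg s hs] at h₁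
    linarith
  · intro s hs
    have h₁ := ConvexBody.support_add_right Z.1 (s • e 1) (e 2)
    have h₂ := hZ 0 s 0
    have h₃ := hZ 0 0 1
    simp only [abs_zero, zero_smul, zero_add, abs_one, one_smul, add_zero, hf0, h0f,
      abs_of_nonneg hs] at h₂ h₃
    rwa [hZg s hs, h₂, h₃] at h₁
  · intro N c ε hN hc hε
    have hN' : (0 : ℝ) < N := by exact_mod_cast hN
    have hD : (0 : ℝ) < N * (1 + 2 * (c + N)) := by positivity
    -- Steps `ε` and `-ε` along `e 0` both raise `|x| + |y|` by `ε`: this is the ridge.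
    have hdiff : ∀ y z : ℝ, 0 ≤ y → 0 ≤ z →
        secondDifference (ε • e 0) Z.1.support (y • e 1 + z • e 2) =
          2 * (f (y + ε) z - f y z) := fun y z hy hz => by
      have h₁ := hZ ε y z
      have h₂ := hZ (-ε) y z
      have h₃ := hZ 0 y z
      simp only [abs_neg, abs_of_nonneg hy, abs_of_nonneg hz, abs_of_nonneg hε.le, abs_zero,
        zero_smul, zero_add] at h₁ h₂ h₃
      rw [secondDifference, show y • e 1 + z • e 2 + ε • e 0 = ε • e 0 + y • e 1 + z • e 2 by abel,
        show y • e 1 + z • e 2 - ε • e 0 = (-ε) • e 0 + y • e 1 + z • e 2 by module, h₁, h₂, h₃,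
        add_comm ε]
      ring
    have h := Z.2.1.sum_secondDifference_le N hc (ε • e 0) (e 1) (e 2)
    have h₀ := hdiff 0 0 le_rfl le_rfl
    have hδ := hdiff 0 (N * (1 + 2 * (c + N)) : ℝ)⁻¹ le_rfl (by positivity)
    have hi : ∀ i ∈ Finset.range N, secondDifference (ε • e 0) Z.1.support ((c + i) • e 1 + e 2) =
        2 * (f (c + i + ε) 1 - f (c + i) 1) := fun i _ => by
      simpa using hdiff (c + i) 1 (by positivity) zero_le_one
    simp only [zero_smul, zero_add, hf0, abs_of_nonneg hε.le, abs_zero, sub_zero, h0f] at h₀ hδ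
    rw [Finset.sum_congr rfl hi, ← Finset.mul_sum, h₀, hδ, abs_of_pos (inv_pos.2 hD)] at h
    -- Homogeneity rescales the second argument from `D⁻¹` to `1`, where `D = N * (1 + 2 * (c +
    -- N))`.
    have hs := hmul _ (ε * (N * (1 + 2 * (c + N)))) 1 (inv_pos.2 hD)
    rw [mul_one, mul_comm ε, inv_mul_cancel_left₀ hD.ne', mul_comm _ ε] at hs
    rw [hs] at h
    linarith

theorem scalarOp_eq_add (hcont : HausdorffContinuous op) (hgl : GLCovariant op)
    (hid : HasIdentityProperty op) {e : Fin 3 → E} (he : Orthonormal ℝ e) {s t : ℝ}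
    (hs : 0 ≤ s) (ht : 0 ≤ t) : scalarOp op (e 0) s t = s + t := by
  rcases hs.eq_or_lt with rfl | hs
  · rw [scalarOp_zero_left hid (he.1 0), abs_of_nonneg ht, zero_add]
  rcases ht.eq_or_lt with rfl | ht
  · rw [scalarOp_zero_right hid (he.1 0), abs_of_pos hs, add_zero]
  have h := scalarOp_mul hgl (e 0) ht (s / t) 1
  rw [scalarOp_one hcont hgl hid he (div_pos hs ht), mul_one, mul_div_cancel₀ _ ht.ne'] at h
  rw [h]
  field_simp

theorem exists_orthonormal (hn : 3 ≤ n) : ∃ e : Fin 3 → E, Orthonormal ℝ e :=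
  ⟨_, (EuclideanSpace.basisFun (Fin n) ℝ).orthonormal.comp (Fin.castLE hn)
    (Fin.castLE_injective hn)⟩

theorem isMinkowskiAddition_of_covariant (hn : 3 ≤ n) (hcont : HausdorffContinuous op)
    (hgl : GLCovariant op) (hid : HasIdentityProperty op) : IsMinkowskiAddition op := by
  obtain ⟨e, he⟩ := exists_orthonormal hn
  intro K L
  refine ConvexBody.ext_support fun u => ?_
  rw [support_op hcont hgl hid (he.1 0), ConvexBody.support_add,
    scalarOp_eq_add hcont hgl hid he (ConvexBody.support_nonneg K.2.2 u)
      (ConvexBody.support_nonneg L.2.2 u)]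

/-! ### The converse: Minkowski addition has the three properties. -/

namespace IsMinkowskiAddition

theorem hausdorffContinuous (h : IsMinkowskiAddition op) : HausdorffContinuous op := by
  intro K L M N hK hL
  rw [tendsto_subtype_rng] at *
  simp only [h _ _]
  exact ConvexBody.tendsto_add hK hL

theorem glCovariant (h : IsMinkowskiAddition op) : GLCovariant op := fun φ K L =>
  Subtype.ext <| by
    rw [h]
    change glImageBody φ (op K L).1 = glImageBody φ K.1 + glImageBody φ L.1
    rw [h, glImageBody_add]

theorem hasIdentityProperty (h : IsMinkowskiAddition op) : HasIdentityProperty op := fun K =>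
  ⟨Subtype.ext <| (h K (origin n)).trans (add_zero K.1),
    Subtype.ext <| (h (origin n) K).trans (zero_add K.1)⟩

end IsMinkowskiAddition

end SymmZonoid

theorem corollary5p2 (n : ℕ) (hn : 3 ≤ n) (op : SymmZonoid n → SymmZonoid n → SymmZonoid n) :
    (SymmZonoid.HausdorffContinuous op ∧ SymmZonoid.GLCovariant op ∧
        SymmZonoid.HasIdentityProperty op) ↔
      SymmZonoid.IsMinkowskiAddition op :=
  ⟨fun ⟨hcont, hgl, hid⟩ => SymmZonoid.isMinkowskiAddition_of_covariant hn hcont hgl hid,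
    fun h => ⟨h.hausdorffContinuous, h.glCovariant, h.hasIdentityProperty⟩⟩
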